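/- **Setting.** Let $M,N,L,K$ be nonnegative integers, $H_{tp}\in\mathbb{C}^{M\times L}$, $H_{pr}\in\mathbb{C}^{N\times L}$, $H_{tr}\in\mathbb{C}^{N\times M}$, $H_{pe}\in\mathbb{C}^{K\times L}$, $H_{te}\in\mathbb{C}^{K\times M}$ arbitrary channel matrices, $\alpha,\beta\in[0,1]$, $\sigma_r,\sigma_e>0$, and $P\in\mathbb{R}$. Put $D=\mathrm{diag}\{\sqrt{1/M}\,H_{tp}^H\mathbf 1_M\}$, $A=H_{pr}DD^HH_{pr}^H$, $B=H_{pe}DD^HH_{pe}^H$ and, for a Hermitian matrix $\Lambda\in\mathbb{C}^{M\times M}$, $$R_r(\Lambda)=\alpha H_{pr}\big((H_{tp}^H\Lambda H_{tp})\circ I\big)H_{pr}^H+\beta H_{tr}\Lambda H_{tr}^H+\sigma_r^2 I,\qquad R_e(\Lambda)=H_{pe}\big((H_{tp}^H\Lambda H_{tp})\circ I\big)H_{pe}^H+H_{te}\Lambda H_{te}^H+\sigma_e^2 I,$$ where $\circ$ is the entrywise product. The secrecy-rate-maximization problem is to maximize $$C_s(P_s,\Lambda)=\ln\det(R_r(\Lambda)+P_sA)+\ln\det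 R_e(\Lambda)-\ln\det R_r(\Lambda)-\ln\det(R_e(\Lambda)+P_sB)$$ over $\mathcal C=\{(P_s,\Lambda): P_s+\mathrm{Tr}\,\Lambda\le P,\ P_s\ge 0,\ \Lambda\succeq 0\}$. The achievable secrecy rate in bits is $[\log_2\det(I+P_sAR_r(\Lambda)^{-1})-\log_2\det(I+P_sBR_e(\Lambda)^{-1})]^+$. *Alternating optimization (AO).* Start at any $(P_s^0,\Lambda^0)\in\mathcal C$. For $n\ge1$, let $(S_0^n,S_1^n)$ be a maximizer over $S_0,S_1\succeq0$ of $\ln\det S_0-\mathrm{Tr}(S_0R_r(\Lambda^{n-1}))+\ln\det S_1-\mathrm{Tr}(S_1(R_e(\Lambda^{n-1})+P_s^{n-1}B))$ (with $\ln 0=-\infty$), and let $(P_s^n,\Lambda^n)$ be a maximizer over $\mathcal C$ of $\ln\det(R_r(\Lambda)+P_sA)+\ln\det R_e(\Lambda)-\mathrm{Tr}(S_0^nR_r(\Lambda))-\mathrm{Tr}(S_1^n(R_e(\Lambda)+P_sB))$. *Sequential parametric convex approximation (SPCA).* Start at any $(P_s^0,\Lambda^0)\in\mathcal C$. For $n\ge1$,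 let $(P_s^n,\Lambda^n)$ be a maximizer over $\mathcal C$ of $\ln\det(R_r(\Lambda)+P_sA)+\ln\det R_e(\Lambda)-T_{R_r(\Lambda^{n-1})}(R_r(\Lambda))-T_{R_e(\Lambda^{n-1})+P_s^{n-1}B}(R_e(\Lambda)+P_sB)$, where $T_{X_0}(X)=\ln\det X_0+\mathrm{Tr}(X_0^{-1}(X-X_0))$. A *KKT point* is a point $(P_s,\Lambda)\in\mathcal C$ for which there are $\lambda,\mu\ge0$ and $Z\succeq0$ with $\lambda(P-P_s-\mathrm{Tr}\,\Lambda)=0$, $\mu P_s=0$, $\mathrm{Tr}(Z\Lambda)=0$, such that the Lagrangian $C_s(P_s,\Lambda)+\lambda(P-P_s-\mathrm{Tr}\,\Lambda)+\mu P_s+\mathrm{Tr}(Z\Lambda)$, with $\lambda,\mu,Z$ fixed, has zero derivative at the point in every direction of $\mathbb{R}\times\{\text{Hermitian }M\times M\text{ matrices}\}$. **Theorem.** Let $(P_s^n,\Lambda^n)_{n\ge0}$ be any sequence generated by the AO method or by the SPCA method (for any choice of the maximizers). Then: 1. $C_s(P_s^n,\Lambda^n)$ and the achievable secrecy rates in bits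 at $(P_s^n,\Lambda^n)$ are non-decreasing in $n$. 2. The sequence has a limit point (accumulation point). Every limit point is a KKT point of the original non-convex problem, and $C_s(P_s^n,\Lambda^n)$ converges to the value of $C_s$ there. 3. The sequence converges to the set of KKT points: every neighbourhood of this set contains all but finitely many iterates. 4. If some limit point is an isolated point of the set of KKT points, then the whole sequence converges to this KKT point. -/

import Mathlib

open Filter
open scoped Topology Matrix ComplexOrder

noncomputable section

/-- Natural logarithm of the determinant of a matrix with real positive determinant. -/
def logDet {n : ℕ} (X : Matrix (Fin n) (Fin n) ℂ) : ℝ :=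
  Real.log X.det.re

/-- Extended-real `ln det` on positive semidefinite matrices: it is `-∞` at singular matrices. -/
def elogDet {n : ℕ} (X : Matrix (Fin n) (Fin n) ℂ) : EReal :=
  ENNReal.log (ENNReal.ofReal X.det.re)

/-- First-order Taylor expansion of `ln det` around `X₀`, evaluated at `X`. -/
def logDetTangent {n : ℕ} (X₀ X : Matrix (Fin n) (Fin n) ℂ) : ℝ :=
  logDet X₀ + (X₀⁻¹ * (X - X₀)).trace.re

/-- Data of a MIMO backscatter system: a reader with `M` transmitting and `N` receiving antennas,
a tag with `L` antennas, and an eavesdropper with `K` receiving antennas. -/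
structure BackscatterSystem (M N L K : ℕ) where
  /-- the channel from the reader to the tag is the conjugate transpose of `Htp` -/
  Htp : Matrix (Fin M) (Fin L) ℂ
  /-- channel from the tag to the reader -/
  Hpr : Matrix (Fin N) (Fin L) ℂ
  /-- self-interference channel at the reader -/
  Htr : Matrix (Fin N) (Fin M) ℂ
  /-- channel from the tag to the eavesdropper -/
  Hpe : Matrix (Fin K) (Fin L) ℂ
  /-- channel from the reader to the eavesdropper -/
  Hte : Matrix (Fin K) (Fin M) ℂ
  /-- attenuation factor of the backscattered artificial noise -/
  α : ℝ
  /-- attenuation factor of the self-interference -/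
  β : ℝ
  /-- noise standard deviation at the reader -/
  σr : ℝ
  /-- noise standard deviation at the eavesdropper -/
  σe : ℝ

namespace BackscatterSystem

variable {M N L K : ℕ} (sys : BackscatterSystem M N L K)

/-- `diag (√(1/M) Htpᴴ 1)`. -/
def Dtp : Matrix (Fin L) (Fin L) ℂ :=
  Matrix.diagonal (((Real.sqrt (1 / (M : ℝ)) : ℝ) : ℂ) • (sys.Htpᴴ *ᵥ fun _ => (1 : ℂ)))

/-- `A = Hpr Dtp Dtpᴴ Hprᴴ`. -/
def A : Matrix (Fin N) (Fin N) ℂ :=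
  sys.Hpr * sys.Dtp * sys.Dtpᴴ * sys.Hprᴴ

/-- `B = Hpe Dtp Dtpᴴ Hpeᴴ`. -/
def B : Matrix (Fin K) (Fin K) ℂ :=
  sys.Hpe * sys.Dtp * sys.Dtpᴴ * sys.Hpeᴴ

/-- Covariance of the artificial noise after the tag: the diagonal part of `Htpᴴ Λ Htp`. -/
def tagCov (Λ : Matrix (Fin M) (Fin M) ℂ) : Matrix (Fin L) (Fin L) ℂ :=
  (sys.Htpᴴ * Λ * sys.Htp) ⊙ 1

/-- Interference-plus-noise covariance at the reader. -/
def Rr (Λ : Matrix (Fin M) (Fin M) ℂ) : Matrix (Fin N) (Fin N) ℂ :=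
  (sys.α : ℂ) • (sys.Hpr * sys.tagCov Λ * sys.Hprᴴ)
    + (sys.β : ℂ) • (sys.Htr * Λ * sys.Htrᴴ)
    + ((sys.σr ^ 2 : ℝ) : ℂ) • (1 : Matrix (Fin N) (Fin N) ℂ)

/-- Interference-plus-noise covariance at the eavesdropper. -/
def Re (Λ : Matrix (Fin M) (Fin M) ℂ) : Matrix (Fin K) (Fin K) ℂ :=
  sys.Hpe * sys.tagCov Λ * sys.Hpeᴴ
    + sys.Hte * Λ * sys.Hteᴴ
    + ((sys.σe ^ 2 : ℝ) : ℂ) • (1 : Matrix (Fin K) (Fin K) ℂ)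

/-- `R_r + P_s A` at the point `x = (P_s, Λ_z)`. -/
def RrA (x : ℝ × Matrix (Fin M) (Fin M) ℂ) : Matrix (Fin N) (Fin N) ℂ :=
  sys.Rr x.2 + (x.1 : ℂ) • sys.A

/-- `R_e + P_s B` at the point `x = (P_s, Λ_z)`. -/
def ReB (x : ℝ × Matrix (Fin M) (Fin M) ℂ) : Matrix (Fin K) (Fin K) ℂ :=
  sys.Re x.2 + (x.1 : ℂ) • sys.B

/-- Achievable secrecy rate `[C_r - C_e]⁺`, in bits. -/
def achievableSecrecyRate (x : ℝ × Matrix (Fin M) (Fin M) ℂ) : ℝ :=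
  max 0
    (Real.logb 2 (1 + (x.1 : ℂ) • (sys.A * (sys.Rr x.2)⁻¹)).det.re
      - Real.logb 2 (1 + (x.1 : ℂ) • (sys.B * (sys.Re x.2)⁻¹)).det.re)

/-- The concave part `ln det (R_r + P_s A) + ln det R_e` of the objective. -/
def f₀ (x : ℝ × Matrix (Fin M) (Fin M) ℂ) : ℝ :=
  logDet (sys.RrA x) + logDet (sys.Re x.2)

/-- The objective of the secrecy rate maximization problem (in nats, without positive part). -/
def Cs (x : ℝ × Matrix (Fin M) (Fin M) ℂ) : ℝ :=
  logDet (sys.RrA x) + logDet (sys.Re x.2) - logDet (sys.Rr x.2) - logDet (sys.ReB x)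

end BackscatterSystem

/-- The feasible set: `P_s + Tr Λ_z ≤ P`, `P_s ≥ 0`, `Λ_z ⪰ 0`. -/
def feasibleSet (M : ℕ) (P : ℝ) : Set (ℝ × Matrix (Fin M) (Fin M) ℂ) :=
  {x | x.1 + x.2.trace.re ≤ P ∧ 0 ≤ x.1 ∧ x.2.PosSemidef}

namespace BackscatterSystem

variable {M N L K : ℕ} (sys : BackscatterSystem M N L K)

/-- The objective, in the auxiliary variables `(S₀, S₁)`, of the first half-step of alternating
optimization, at the current point `y`. -/
def aoAuxObjective (y : ℝ × Matrix (Fin M) (Fin M) ℂ)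
    (S : Matrix (Fin N) (Fin N) ℂ × Matrix (Fin K) (Fin K) ℂ) : EReal :=
  elogDet S.1 + elogDet S.2
    + ((-(S.1 * sys.Rr y.2).trace.re - (S.2 * sys.ReB y).trace.re : ℝ) : EReal)

/-- The objective, in `x = (P_s, Λ_z)`, of the second half-step of alternating optimization. -/
def aoObjective (S : Matrix (Fin N) (Fin N) ℂ × Matrix (Fin K) (Fin K) ℂ)
    (x : ℝ × Matrix (Fin M) (Fin M) ℂ) : ℝ :=
  logDet (sys.RrA x) + logDet (sys.Re x.2)
    - (S.1 * sys.Rr x.2).trace.re - (S.2 * sys.ReB x).trace.re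

/-- `x` is a sequence of iterates of the alternating optimization method. -/
def IsAOSequence (P : ℝ) (x : ℕ → ℝ × Matrix (Fin M) (Fin M) ℂ) : Prop :=
  x 0 ∈ feasibleSet M P ∧
    ∃ S : ℕ → Matrix (Fin N) (Fin N) ℂ × Matrix (Fin K) (Fin K) ℂ, ∀ n,
      ((S (n + 1)).1.PosSemidef ∧ (S (n + 1)).2.PosSemidef ∧
        IsMaxOn (sys.aoAuxObjective (x n)) {T | T.1.PosSemidef ∧ T.2.PosSemidef} (S (n + 1))) ∧
      (x (n + 1) ∈ feasibleSet M P ∧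
        IsMaxOn (sys.aoObjective (S (n + 1))) (feasibleSet M P) (x (n + 1)))

/-- The objective of the convex problem solved by the SPCA method at the current point `y`: the
terms `-ln det R_r` and `-ln det (R_e + P_s B)` are replaced by their tangents at `y`. -/
def spcaObjective (y x : ℝ × Matrix (Fin M) (Fin M) ℂ) : ℝ :=
  sys.f₀ x - logDetTangent (sys.Rr y.2) (sys.Rr x.2) - logDetTangent (sys.ReB y) (sys.ReB x)

/-- `x` is a sequence of iterates of the sequential parametric convex approximation method. -/
def IsSPCASequence (P : ℝ) (x : ℕ → ℝ × Matrix (Fin M) (Fin M) ℂ) : Prop :=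
  x 0 ∈ feasibleSet M P ∧
    ∀ n, x (n + 1) ∈ feasibleSet M P ∧
      IsMaxOn (sys.spcaObjective (x n)) (feasibleSet M P) (x (n + 1))

/-- The Lagrangian of the secrecy rate maximization problem, with multipliers `l`, `m`, `Z` for
the constraints `P_s + Tr Λ_z ≤ P`, `P_s ≥ 0`, `Λ_z ⪰ 0`. -/
def lagrangian (P l m : ℝ) (Z : Matrix (Fin M) (Fin M) ℂ)
    (x : ℝ × Matrix (Fin M) (Fin M) ℂ) : ℝ :=
  sys.Cs x + l * (P - x.1 - x.2.trace.re) + m * x.1 + (Z * x.2).trace.re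

/-- Karush-Kuhn-Tucker points of the secrecy rate maximization problem: primal feasibility, dual
feasibility, complementary slackness, and stationarity of the Lagrangian in the real vector space
of pairs (real number, Hermitian matrix). -/
def IsKKT (P : ℝ) (x : ℝ × Matrix (Fin M) (Fin M) ℂ) : Prop :=
  x ∈ feasibleSet M P ∧
    ∃ (l m : ℝ) (Z : Matrix (Fin M) (Fin M) ℂ),
      0 ≤ l ∧ 0 ≤ m ∧ Z.PosSemidef ∧
      l * (P - x.1 - x.2.trace.re) = 0 ∧ m * x.1 = 0 ∧ (Z * x.2).trace = 0 ∧
      ∀ v : ℝ × Matrix (Fin M) (Fin M) ℂ, v.2.IsHermitian →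
        HasLineDerivAt ℝ (sys.lagrangian P l m Z) 0 x v

end BackscatterSystem

end

/-!
Alternating optimization (AO) and SPCA generate the same iterates: for positive definite `X` the
function `S ↦ log det S - tr (S X)` has the unique maximizer `X⁻¹`
(`Matrix.PosDef.logDet_sub_trace_le`), and with this `S` the second half-step of AO has the SPCA
objective up to a constant (`IsAOSequence.isSPCASequence`). So only SPCA has to be studied. Write
`spca y` for its objective linearized at `y`.

As `log det` is concave, `spca y` minorizes `Cs`, agrees with `Cs` to first order at `y`, and
`spca y x = Cs x` forces `Rr` and `Re + Ps B` to take the same values at `x` and at `y`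
(`spcaObjective_le`). Hence
`Cs (x n) ≤ spca (x n) (x (n + 1)) ≤ Cs (x (n + 1))`, which is monotonicity; the rate in bits is
the positive part of `Cs / log 2`. The feasible set is compact, so limit points exist. All limits
are taken along ultrafilters `F ≤ atTop`. If `x n → z` along `F`, then
`spca (x n) y ≤ Cs (x (n + 1))` for every feasible `y` gives that `z` maximizes `spca z`
(`IsSPCASequence.isMaxOn_of_tendsto`); the first-order condition together with explicit multipliers
(`exists_multipliers_of_forall_le`) shows that `z` is a KKT point (`isKKT_of_isMaxOn`). Convergence
to the set of KKT points is then a property of sequences in compact sets.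

For an isolated limit point `z`, let also `x (n + 1) → w` along `F`. Then
`spca z w = Cs w = Cs z`, so `Rr` and `Re + Ps B` agree at `z` and `w`, hence on the segment
between them by affinity, and concavity makes every point `u` of this segment a maximizer of
`spca u = spca z`. Thus the segment consists of KKT points and `w = z`
(`IsSPCASequence.eq_of_tendsto_succ`). Consequently the iterates leave a small closed neighbourhood
of `z` only finitely often, although they visit it infinitely often.
-/

/-! ### `log det` on positive definite matrices -/

namespace Matrix

theorem PosDef.det_re_pos {n : ℕ} {X : Matrix (Fin n) (Fin n) ℂ} (hX : X.PosDef) :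
    0 < X.det.re :=
  (Complex.pos_iff.1 hX.det_pos).1

theorem PosDef.det_im_eq_zero {n : ℕ} {X : Matrix (Fin n) (Fin n) ℂ} (hX : X.PosDef) :
    X.det.im = 0 :=
  (Complex.pos_iff.1 hX.det_pos).2.symm

theorem PosSemidef.posDef_of_det_re_ne_zero {n : ℕ} {X : Matrix (Fin n) (Fin n) ℂ}
    (hX : X.PosSemidef) (h : X.det.re ≠ 0) : X.PosDef :=
  hX.posDef_iff_det_ne_zero.2 fun h0 => h (by rw [h0, Complex.zero_re])

theorem isClosed_posSemidef (n : ℕ) : IsClosed {X : Matrix (Fin n) (Fin n) ℂ | X.PosSemidef} := by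
  have h : {X : Matrix (Fin n) (Fin n) ℂ | X.PosSemidef} =
      {X | Xᴴ = X} ∩ ⋂ v : Fin n → ℂ, {X | 0 ≤ star v ⬝ᵥ (X *ᵥ v)} := by
    ext X
    simp only [Set.mem_ofPred_eq, posSemidef_iff_dotProduct_mulVec, Set.mem_inter_iff,
      Set.mem_iInter]
    rfl
  rw [h]
  refine (isClosed_eq (by fun_prop) (by fun_prop)).inter (isClosed_iInter fun v => ?_)
  exact isClosed_le (by fun_prop) (by fun_prop)

/-- The entries of a positive semidefinite matrix are bounded by its trace. -/
theorem PosSemidef.norm_apply_le_trace {n : ℕ} {X : Matrix (Fin n) (Fin n) ℂ}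
    (hX : X.PosSemidef) (i j : Fin n) : ‖X i j‖ ≤ X.trace.re := by
  obtain ⟨B, rfl⟩ : ∃ B : Matrix (Fin n) (Fin n) ℂ, X = Bᴴ * B := by
    open scoped MatrixOrder in
    exact CStarAlgebra.nonneg_iff_eq_star_mul_self.1 hX.nonneg
  have key : ∀ k, ∑ l, ‖B l k‖ ^ 2 ≤ (Bᴴ * B).trace.re := by
    intro k
    have : (Bᴴ * B).trace.re = ∑ k, ∑ l, ‖B l k‖ ^ 2 := by
      simp [trace, mul_apply, ← Complex.normSq_eq_conj_mul_self, Complex.normSq_eq_norm_sq]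
      simp only [← Complex.ofReal_pow, Complex.ofReal_re]
    rw [this]
    exact Finset.single_le_sum (f := fun k => ∑ l, ‖B l k‖ ^ 2)
      (fun _ _ => by positivity) (Finset.mem_univ k)
  calc ‖(Bᴴ * B) i j‖ ≤ ∑ l, ‖B l i‖ * ‖B l j‖ := by
        rw [mul_apply]
        refine (norm_sum_le _ _).trans (le_of_eq ?_)
        simp
    _ ≤ ∑ l, (‖B l i‖ ^ 2 + ‖B l j‖ ^ 2) / 2 := by
        gcongr with l
        nlinarith [sq_nonneg (‖B l i‖ - ‖B l j‖)]
    _ = (∑ l, ‖B l i‖ ^ 2 + ∑ l, ‖B l j‖ ^ 2) / 2 := by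
        rw [← Finset.sum_div, Finset.sum_add_distrib]
    _ ≤ _ := by linarith [key i, key j]

theorem PosSemidef.trace_mul_nonneg {n : ℕ} {X Y : Matrix (Fin n) (Fin n) ℂ}
    (hX : X.PosSemidef) (hY : Y.PosSemidef) : 0 ≤ (X * Y).trace := by
  obtain ⟨B, rfl⟩ : ∃ B : Matrix (Fin n) (Fin n) ℂ, Y = Bᴴ * B := by
    open scoped MatrixOrder in
    exact CStarAlgebra.nonneg_iff_eq_star_mul_self.1 hY.nonneg
  rw [← mul_assoc, trace_mul_comm, ← mul_assoc]
  exact (hX.mul_mul_conjTranspose_same B).trace_nonneg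

/-- For positive definite `Y` this is `∑ (log λ - λ + 1) ≤ 0` over the eigenvalues, with equality
only if all of them are `1`. -/
theorem PosDef.log_det_le_trace {n : ℕ} {Y : Matrix (Fin n) (Fin n) ℂ} (hY : Y.PosDef) :
    Real.log Y.det.re ≤ Y.trace.re - n ∧ (Real.log Y.det.re = Y.trace.re - n → Y = 1) := by
  have hpos := hY.eigenvalues_pos
  set d := hY.isHermitian.eigenvalues with hd
  have hdet : Real.log Y.det.re = ∑ i, Real.log (d i) := by
    rw [hY.isHermitian.det_eq_prod_eigenvalues, ← Real.log_prod fun i _ => (hpos i).ne']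
    congr 1
    exact_mod_cast Complex.ofReal_re (∏ i, d i)
  have htr : Y.trace.re - n = ∑ i, (d i - 1) := by
    rw [hY.isHermitian.trace_eq_sum_eigenvalues]
    simp [hd]
  have hle : ∀ i, Real.log (d i) ≤ d i - 1 := fun i => Real.log_le_sub_one_of_pos (hpos i)
  rw [hdet, htr]
  refine ⟨Finset.sum_le_sum fun i _ => hle i, fun h => ?_⟩
  have h1 : ∀ i, d i = 1 := by
    intro i
    by_contra hne
    exact (Real.log_lt_sub_one_of_pos (hpos i) hne).ne
      ((Finset.sum_eq_sum_iff_of_le fun i _ => hle i).1 h i (Finset.mem_univ i))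
  rw [hY.isHermitian.spectral_theorem]
  have : (RCLike.ofReal ∘ hY.isHermitian.eigenvalues : Fin n → ℂ) = 1 := by
    funext i
    simpa using h1 i
  rw [this]
  simp [Pi.one_def]

/-- The concave function `S ↦ log det S - tr (S X)` of positive definite `S` has `X⁻¹` as its only
maximizer. -/
theorem PosDef.logDet_sub_trace_le {n : ℕ} {S X : Matrix (Fin n) (Fin n) ℂ}
    (hS : S.PosDef) (hX : X.PosDef) :
    logDet S - (S * X).trace.re ≤ -logDet X - n ∧
      (logDet S - (S * X).trace.re = -logDet X - n → S = X⁻¹) := by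
  -- With `X = Cᴴ C` the claim is the eigenvalue inequality for `C S Cᴴ`.
  obtain ⟨C, rfl⟩ : ∃ C : Matrix (Fin n) (Fin n) ℂ, X = Cᴴ * C := by
    open scoped MatrixOrder in
    exact CStarAlgebra.nonneg_iff_eq_star_mul_self.1 hX.posSemidef.nonneg
  have hC : IsUnit C.det := by
    have := hX.det_pos.ne'
    rw [det_mul] at this
    exact (right_ne_zero_of_mul this).isUnit
  have hY : (C * S * Cᴴ).PosDef :=
    hS.mul_mul_conjTranspose_same (vecMul_injective_of_isUnit ((isUnit_iff_isUnit_det C).2 hC))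
  have htr : (C * S * Cᴴ).trace = (S * (Cᴴ * C)).trace := by
    rw [mul_assoc, trace_mul_comm, mul_assoc]
  have hdet : Real.log (C * S * Cᴴ).det.re = logDet S + logDet (Cᴴ * C) := by
    rw [logDet, logDet, ← Real.log_mul hS.det_re_pos.ne' hX.det_re_pos.ne']
    congr 1
    have : (C * S * Cᴴ).det = S.det * (Cᴴ * C).det := by
      simp only [det_mul]; ring
    rw [this, Complex.mul_re, hS.det_im_eq_zero]
    simp
  obtain ⟨h1, h2⟩ := hY.log_det_le_trace
  rw [hdet, htr] at h1 h2
  refine ⟨by linarith, fun h => ?_⟩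
  have h3 : C * S * Cᴴ = 1 := h2 (by linarith)
  symm
  apply inv_eq_left_inv
  have h4 : S * Cᴴ * C = 1 := mul_eq_one_comm.1 (by rw [← mul_assoc, h3])
  rw [← mul_assoc, h4]

theorem PosDef.logDet_inv {n : ℕ} {X : Matrix (Fin n) (Fin n) ℂ} (hX : X.PosDef) :
    logDet X⁻¹ = -logDet X := by
  have h := hX.det_im_eq_zero
  rw [logDet, logDet, det_nonsing_inv, Ring.inverse_eq_inv', Complex.inv_re, Complex.normSq_apply,
    h, ← Real.log_inv]
  congr 1
  have := hX.det_re_pos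
  field_simp
  ring

/-- `log det` is concave: it lies below its tangents and touches them only at the base point. -/
theorem PosDef.logDet_le_logDetTangent {n : ℕ} {X₀ X : Matrix (Fin n) (Fin n) ℂ}
    (hX₀ : X₀.PosDef) (hX : X.PosDef) :
    logDet X ≤ logDetTangent X₀ X ∧ (logDet X = logDetTangent X₀ X → X = X₀) := by
  obtain ⟨h1, h2⟩ := hX.logDet_sub_trace_le hX₀.inv
  have h3 : logDetTangent X₀ X = logDet X₀ + (X * X₀⁻¹).trace.re - n := by
    rw [logDetTangent, mul_sub, trace_sub, nonsing_inv_mul _ ((isUnit_iff_isUnit_det _).1 hX₀.isUnit),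
      trace_mul_comm]
    simp
    ring
  rw [hX₀.logDet_inv] at h1 h2
  rw [nonsing_inv_nonsing_inv _ ((isUnit_iff_isUnit_det _).1 hX₀.isUnit)] at h2
  rw [h3]
  exact ⟨by linarith, fun h => h2 (by linarith)⟩

theorem logDetTangent_self {n : ℕ} (X : Matrix (Fin n) (Fin n) ℂ) :
    logDetTangent X X = logDet X := by
  simp [logDetTangent]

/-- Concavity of `log det`: both `X` and `Y` satisfy the tangent inequality at their convex
combination, where the linear terms cancel. -/
theorem PosDef.le_logDet_convexCombo {n : ℕ} {X Y : Matrix (Fin n) (Fin n) ℂ}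
    (hX : X.PosDef) (hY : Y.PosDef) {a b : ℝ} (ha : 0 ≤ a) (hb : 0 ≤ b) (hab : a + b = 1)
    (hU : ((a : ℂ) • X + (b : ℂ) • Y).PosDef) :
    a * logDet X + b * logDet Y ≤ logDet ((a : ℂ) • X + (b : ℂ) • Y) := by
  set U := (a : ℂ) • X + (b : ℂ) • Y with hUdef
  have h1 := mul_le_mul_of_nonneg_left (hU.logDet_le_logDetTangent hX).1 ha
  have h2 := mul_le_mul_of_nonneg_left (hU.logDet_le_logDetTangent hY).1 hb
  have h3 : a * (U⁻¹ * (X - U)).trace.re + b * (U⁻¹ * (Y - U)).trace.re = 0 := by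
    have h4 : (a : ℂ) • (X - U) + (b : ℂ) • (Y - U) = 0 := by
      have : (a : ℂ) • (X - U) + (b : ℂ) • (Y - U) = U - ((a : ℂ) + b) • U := by
        rw [hUdef]; module
      rw [this, ← Complex.ofReal_add, hab]
      simp
    have h5 := congrArg (fun V => (U⁻¹ * V).trace.re) h4
    simpa [mul_add] using h5
  have h6 : b = 1 - a := by linarith
  unfold logDetTangent at h1 h2
  subst h6
  linarith

/-- Jacobi's formula for `log det` along a line. -/
theorem PosDef.hasDerivAt_logDet {n : ℕ} {X : Matrix (Fin n) (Fin n) ℂ} (hX : X.PosDef)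
    (V : Matrix (Fin n) (Fin n) ℂ) :
    HasDerivAt (fun t : ℝ => logDet (X + (t : ℂ) • V)) (X⁻¹ * V).trace.re 0 := by
  have hdet : ∀ t : ℂ, (X + t • V).det = X.det * (1 + t • (X⁻¹ * V)).det := by
    intro t
    rw [← det_mul, mul_add, mul_one, mul_smul_comm, ← mul_assoc,
      mul_nonsing_inv _ ((isUnit_iff_isUnit_det _).1 hX.isUnit), one_mul]
  have h1 : HasDerivAt (fun t : ℂ => (X + t • V).det) (X.det * (X⁻¹ * V).trace) 0 := by
    rw [funext hdet]
    have hexp := fun t : ℂ => det_one_add_smul t (X⁻¹ * V)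
    rw [funext fun t => congrArg (X.det * ·) (hexp t)]
    generalize (det (1 + (Polynomial.X : Polynomial ℂ) • (X⁻¹ * V).map Polynomial.C)).divX.divX = q
    have h := ((Polynomial.C (X⁻¹ * V).trace * Polynomial.X + 1 +
      q * Polynomial.X ^ 2).hasDerivAt (0 : ℂ)).const_mul X.det
    simpa [add_comm] using h
  have h2 : HasDerivAt (fun t : ℝ => (X + (t : ℂ) • V).det.re) (X.det * (X⁻¹ * V).trace).re 0 :=
    HasDerivAt.real_of_complex (e := fun t : ℂ => (X + t • V).det) (by simpa using h1)
  have h3 := h2.log (by simpa using hX.det_re_pos.ne')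
  unfold logDet
  convert h3 using 1
  have := hX.det_re_pos
  simp [Complex.mul_re, hX.det_im_eq_zero]
  field_simp

theorem PosDef.continuousAt_logDet {n : ℕ} {X : Matrix (Fin n) (Fin n) ℂ} (hX : X.PosDef) :
    ContinuousAt (logDet (n := n)) X := by
  unfold logDet
  exact ContinuousAt.log (by fun_prop) hX.det_re_pos.ne'

theorem PosDef.continuousAt_logDet_comp {E : Type*} [TopologicalSpace E] {n : ℕ}
    {F : E → Matrix (Fin n) (Fin n) ℂ} (hF : Continuous F) {x : E} (hx : (F x).PosDef) :
    ContinuousAt (fun y => logDet (F y)) x :=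
  hx.continuousAt_logDet.comp hF.continuousAt

theorem PosDef.continuousAt_inv {n : ℕ} {X : Matrix (Fin n) (Fin n) ℂ} (hX : X.PosDef) :
    ContinuousAt (fun Y : Matrix (Fin n) (Fin n) ℂ => Y⁻¹) X := by
  have h : (fun Y : Matrix (Fin n) (Fin n) ℂ => Y⁻¹) = fun Y => (Y.det)⁻¹ • Y.adjugate := by
    funext Y
    rw [inv_def, Ring.inverse_eq_inv']
  rw [h]
  exact ContinuousAt.smul (ContinuousAt.inv₀ (by fun_prop) hX.det_pos.ne')
    (continuous_id.matrix_adjugate.continuousAt)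

theorem PosDef.tendsto_logDetTangent {ι : Type*} {l : Filter ι} {n : ℕ}
    {X₀ Y₀ : Matrix (Fin n) (Fin n) ℂ} {X Y : ι → Matrix (Fin n) (Fin n) ℂ} (hX₀ : X₀.PosDef)
    (hX : Tendsto X l (𝓝 X₀)) (hY : Tendsto Y l (𝓝 Y₀)) :
    Tendsto (fun i => logDetTangent (X i) (Y i)) l (𝓝 (logDetTangent X₀ Y₀)) := by
  have h1 : Tendsto (fun i => (X i)⁻¹ * (Y i - X i)) l (𝓝 (X₀⁻¹ * (Y₀ - X₀))) :=
    (hX₀.continuousAt_inv.tendsto.comp hX).mul (hY.sub hX)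
  have h2 : Continuous fun Z : Matrix (Fin n) (Fin n) ℂ => Z.trace.re := by fun_prop
  exact (hX₀.continuousAt_logDet.tendsto.comp hX).add ((h2.tendsto _).comp h1)

end Matrix

/-! ### The feasible set and its multipliers -/

theorem convex_feasibleSet (M : ℕ) (P : ℝ) : Convex ℝ (feasibleSet M P) := by
  rintro y ⟨h1, h2, h3⟩ z ⟨k1, k2, k3⟩ a b ha hb hab
  refine ⟨?_, ?_, (h3.smul ha).add (k3.smul hb)⟩
  · obtain rfl : b = 1 - a := by linarith
    simp
    nlinarith
  · simp
    positivity

theorem isCompact_feasibleSet (M : ℕ) (P : ℝ) : IsCompact (feasibleSet M P) := by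
  have hK : IsCompact ((Set.Icc 0 P) ×ˢ
      (Set.univ.pi fun _ => Set.univ.pi fun _ => Metric.closedBall (0 : ℂ) P :
        Set (Matrix (Fin M) (Fin M) ℂ))) :=
    isCompact_Icc.prod (isCompact_univ_pi fun _ => isCompact_univ_pi fun _ =>
      isCompact_closedBall _ _)
  refine hK.of_isClosed_subset ?_ ?_
  · refine (isClosed_le (f := fun x : ℝ × Matrix (Fin M) (Fin M) ℂ => x.1 + x.2.trace.re)
      (by fun_prop) continuous_const).inter
      ((isClosed_le continuous_const continuous_fst).inter ?_)
    exact (Matrix.isClosed_posSemidef M).preimage continuous_snd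
  · rintro y ⟨h1, h2, h3⟩
    have h4 := (Complex.nonneg_iff.1 h3.trace_nonneg).1
    refine ⟨⟨h2, by linarith⟩, fun i _ j _ => ?_⟩
    rw [mem_closedBall_zero_iff]
    exact (h3.norm_apply_le_trace i j).trans (by linarith)

open Matrix in
/-- Karush-Kuhn-Tucker multipliers exist at a maximizer of a linear functional on the feasible set.
No constraint qualification is needed, as the maximum is `P` times the largest of `0`, `g` and the
eigenvalues of the Hermitian matrix that represents `ψ`. -/
theorem exists_multipliers_of_forall_le {M : ℕ} {P : ℝ} {z : ℝ × Matrix (Fin M) (Fin M) ℂ}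
    (hz : z ∈ feasibleSet M P) (g : ℝ) (ψ : Matrix (Fin M) (Fin M) ℂ →ₗ[ℂ] ℂ)
    (hopt : ∀ y ∈ feasibleSet M P, g * (y.1 - z.1) + (ψ (y.2 - z.2)).re ≤ 0) :
    ∃ (l m : ℝ) (Z : Matrix (Fin M) (Fin M) ℂ),
      0 ≤ l ∧ 0 ≤ m ∧ Z.PosSemidef ∧
      l * (P - z.1 - z.2.trace.re) = 0 ∧ m * z.1 = 0 ∧ (Z * z.2).trace = 0 ∧
      ∀ v : ℝ × Matrix (Fin M) (Fin M) ℂ, v.2.IsHermitian →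
        g * v.1 + (ψ v.2).re + l * (-v.1 - v.2.trace.re) + m * v.1 + (Z * v.2).trace.re = 0 := by
  obtain ⟨hz1, hz2, hz3⟩ := hz
  have hztr := (Complex.nonneg_iff.1 hz3.trace_nonneg).1
  have hP : 0 ≤ P := by linarith
  -- `ψ` is represented by a matrix, of which only the Hermitian part matters.
  set G₀ : Matrix (Fin M) (Fin M) ℂ := of fun j i => ψ (single i j 1) with hG₀
  have hψ : ∀ V, ψ V = (G₀ * V).trace := by
    intro V
    conv_lhs => rw [matrix_eq_sum_single V]
    simp only [map_sum, trace, diag, mul_apply]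
    rw [Finset.sum_comm]
    refine Finset.sum_congr rfl fun j _ => Finset.sum_congr rfl fun i _ => ?_
    rw [show single i j (V i j) = V i j • single i j (1 : ℂ) by simp, map_smul, hG₀, of_apply,
      smul_eq_mul, mul_comm]
  set G : Matrix (Fin M) (Fin M) ℂ := (1 / 2 : ℂ) • (G₀ + G₀ᴴ) with hG
  have hGH : G.IsHermitian := by
    rw [IsHermitian, hG, conjTranspose_smul, conjTranspose_add, conjTranspose_conjTranspose,
      add_comm]
    congr 1
    simp
  have hGψ : ∀ V : Matrix (Fin M) (Fin M) ℂ, V.IsHermitian → (G * V).trace.re = (ψ V).re := by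
    intro V hV
    have h1 : (G₀ᴴ * V).trace = star (G₀ * V).trace := by
      rw [← trace_conjTranspose, conjTranspose_mul, hV.eq, trace_mul_comm]
    rw [hG, smul_mul_assoc, add_mul, trace_smul, trace_add, h1, hψ]
    simp [Complex.mul_re]
    ring
  -- The multiplier of the power constraint is the largest of `0`, `g` and the eigenvalues of `G`.
  set d := hGH.eigenvalues with hd
  obtain ⟨l, hl0, hlg, hld, hl⟩ : ∃ l, 0 ≤ l ∧ g ≤ l ∧ (∀ i, d i ≤ l) ∧
      (l = 0 ∨ l = g ∨ ∃ i, l = d i) := by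
    set T : Finset ℝ := insert 0 (insert g (Finset.univ.image d)) with hT
    have hne : T.Nonempty := ⟨0, by simp [hT]⟩
    refine ⟨T.max' hne, T.le_max' _ (by simp [hT]), T.le_max' _ (by simp [hT]),
      fun i => T.le_max' _ (by simp [hT]), ?_⟩
    have := T.max'_mem hne
    rcases (by simpa only [hT, Finset.mem_insert, Finset.mem_image] using this :
        T.max' hne = 0 ∨ T.max' hne = g ∨ ∃ i ∈ Finset.univ, d i = T.max' hne) with h | h | ⟨i, -, h⟩
    · exact Or.inl h
    · exact Or.inr (Or.inl h)
    · exact Or.inr (Or.inr ⟨i, h.symm⟩)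
  -- `l P` is attained by the linear functional on the feasible set.
  obtain ⟨y, hy, hyl⟩ : ∃ y ∈ feasibleSet M P, g * y.1 + (ψ y.2).re = l * P := by
    rcases hl with h | h | ⟨i, h⟩
    · exact ⟨0, ⟨by simpa using hP, le_rfl, PosSemidef.zero⟩, by simp [h]⟩
    · exact ⟨(P, 0), ⟨by simp, hP, PosSemidef.zero⟩, by simp [h]⟩
    · set q : Fin M → ℂ := WithLp.ofLp (hGH.eigenvectorBasis i) with hq
      have hGq : G *ᵥ q = (d i) • q := hGH.mulVec_eigenvectorBasis i
      have hqq : q ⬝ᵥ star q = 1 := by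
        have h1 := (inner_self_eq_norm_sq_to_K (𝕜 := ℂ) (hGH.eigenvectorBasis i))
        rw [hGH.eigenvectorBasis.norm_eq_one, EuclideanSpace.inner_eq_star_dotProduct] at h1
        simpa using h1
      have hpsd := (posSemidef_vecMulVec_self_star q).smul hP
      refine ⟨(0, P • vecMulVec q (star q)), ⟨?_, le_rfl, hpsd⟩, ?_⟩
      · simp [trace_vecMulVec, hqq]
      · rw [← hGψ _ hpsd.isHermitian]
        simp [mul_vecMulVec, hGq, trace_vecMulVec, hqq, h, mul_comm]
  set Z := (l : ℂ) • (1 : Matrix (Fin M) (Fin M) ℂ) - G with hZ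
  have hZpsd : Z.PosSemidef := by
    set U : Matrix (Fin M) (Fin M) ℂ := ↑hGH.eigenvectorUnitary with hU
    have hUU : U * Uᴴ = 1 := Unitary.mul_star_self_of_mem hGH.eigenvectorUnitary.2
    have h1 : G = U * diagonal (fun i => (d i : ℂ)) * Uᴴ := by
      have := hGH.spectral_theorem
      rw [Unitary.conjStarAlgAut_apply] at this
      exact this
    have h2 : Z = U * diagonal (fun i => ((l - d i : ℝ) : ℂ)) * Uᴴ := by
      have h3 : diagonal (fun i => ((l - d i : ℝ) : ℂ)) =
          (l : ℂ) • (1 : Matrix (Fin M) (Fin M) ℂ) - diagonal (fun i => (d i : ℂ)) := by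
        rw [← diagonal_one, ← diagonal_smul, diagonal_sub]
        congr 1
        funext i
        simp
      rw [h3, mul_sub, sub_mul, ← h1, mul_smul_comm, mul_one, smul_mul_assoc, hUU]
    rw [h2]
    refine PosSemidef.mul_mul_conjTranspose_same (PosSemidef.diagonal fun i => ?_) U
    exact Complex.zero_le_real.2 (sub_nonneg.2 (hld i))
  have hZv : ∀ V : Matrix (Fin M) (Fin M) ℂ, V.IsHermitian →
      (Z * V).trace.re = l * V.trace.re - (ψ V).re := by
    intro V hV
    rw [← hGψ V hV, hZ, sub_mul, trace_sub, smul_mul_assoc, one_mul, trace_smul]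
    simp
  have hZz := Complex.nonneg_iff.1 (hZpsd.trace_mul_nonneg hz3)
  have hopt' : l * P ≤ g * z.1 + (ψ z.2).re := by
    have := hopt y hy
    rw [map_sub, Complex.sub_re] at this
    linarith
  have hsum := hZv z.2 hz3.isHermitian
  have k1 : 0 ≤ l * (P - z.1 - z.2.trace.re) := mul_nonneg hl0 (by linarith)
  have k2 : 0 ≤ (l - g) * z.1 := mul_nonneg (by linarith) hz2
  -- The three nonnegative terms have nonpositive sum, so that each of them vanishes.
  have k3 : l * (P - z.1 - z.2.trace.re) + (l - g) * z.1 + (Z * z.2).trace.re ≤ 0 := by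
    rw [hsum]
    linarith
  refine ⟨l, l - g, Z, hl0, by linarith, hZpsd, by linarith, by linarith, ?_, ?_⟩
  · apply Complex.ext
    · rw [Complex.zero_re]; linarith
    · exact hZz.2.symm
  · intro v hv
    rw [hZv v.2 hv]
    ring

/-! ### Covariance matrices as affine functions -/

noncomputable section

namespace BackscatterSystem

variable {M N L K : ℕ} (sys : BackscatterSystem M N L K)

/-- The linear part of `Rr`. -/
def RrLin : Matrix (Fin M) (Fin M) ℂ →ₗ[ℂ] Matrix (Fin N) (Fin N) ℂ where
  toFun Λ := (sys.α : ℂ) • (sys.Hpr * sys.tagCov Λ * sys.Hprᴴ)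
    + (sys.β : ℂ) • (sys.Htr * Λ * sys.Htrᴴ)
  map_add' X Y := by
    simp only [tagCov, Matrix.mul_add, Matrix.add_mul, Matrix.add_hadamard, smul_add]
    abel
  map_smul' c X := by
    simp only [tagCov, Matrix.mul_smul, Matrix.smul_mul, Matrix.smul_hadamard, smul_add,
      RingHom.id_apply, smul_comm c]

/-- The linear part of `Re`. -/
def ReLin : Matrix (Fin M) (Fin M) ℂ →ₗ[ℂ] Matrix (Fin K) (Fin K) ℂ where
  toFun Λ := sys.Hpe * sys.tagCov Λ * sys.Hpeᴴ + sys.Hte * Λ * sys.Hteᴴ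
  map_add' X Y := by
    simp only [tagCov, Matrix.mul_add, Matrix.add_mul, Matrix.add_hadamard]
    abel
  map_smul' c X := by
    simp only [tagCov, Matrix.mul_smul, Matrix.smul_mul, Matrix.smul_hadamard, smul_add,
      RingHom.id_apply]

theorem Rr_eq (Λ : Matrix (Fin M) (Fin M) ℂ) :
    sys.Rr Λ = sys.RrLin Λ + ((sys.σr ^ 2 : ℝ) : ℂ) • 1 := rfl

theorem Re_eq (Λ : Matrix (Fin M) (Fin M) ℂ) :
    sys.Re Λ = sys.ReLin Λ + ((sys.σe ^ 2 : ℝ) : ℂ) • 1 := rfl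

/-- The linear part of `RrA`. -/
def RrALin (v : ℝ × Matrix (Fin M) (Fin M) ℂ) : Matrix (Fin N) (Fin N) ℂ :=
  sys.RrLin v.2 + (v.1 : ℂ) • sys.A

/-- The linear part of `ReB`. -/
def ReBLin (v : ℝ × Matrix (Fin M) (Fin M) ℂ) : Matrix (Fin K) (Fin K) ℂ :=
  sys.ReLin v.2 + (v.1 : ℂ) • sys.B

theorem Rr_line (X V : Matrix (Fin M) (Fin M) ℂ) (t : ℝ) :
    sys.Rr (X + t • V) = sys.Rr X + (t : ℂ) • sys.RrLin V := by
  rw [Rr_eq, Rr_eq, map_add, ← Complex.coe_smul t V, map_smul]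
  abel

theorem Re_line (X V : Matrix (Fin M) (Fin M) ℂ) (t : ℝ) :
    sys.Re (X + t • V) = sys.Re X + (t : ℂ) • sys.ReLin V := by
  rw [Re_eq, Re_eq, map_add, ← Complex.coe_smul t V, map_smul]
  abel

theorem RrA_line (z v : ℝ × Matrix (Fin M) (Fin M) ℂ) (t : ℝ) :
    sys.RrA (z + t • v) = sys.RrA z + (t : ℂ) • sys.RrALin v := by
  simp only [RrA, RrALin, Prod.snd_add, Prod.fst_add, Prod.smul_fst, Prod.smul_snd, Rr_line,
    smul_eq_mul, Complex.ofReal_add, Complex.ofReal_mul]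
  module

theorem ReB_line (z v : ℝ × Matrix (Fin M) (Fin M) ℂ) (t : ℝ) :
    sys.ReB (z + t • v) = sys.ReB z + (t : ℂ) • sys.ReBLin v := by
  simp only [ReB, ReBLin, Prod.snd_add, Prod.fst_add, Prod.smul_fst, Prod.smul_snd, Re_line,
    smul_eq_mul, Complex.ofReal_add, Complex.ofReal_mul]
  module

theorem Rr_sub (X Y : Matrix (Fin M) (Fin M) ℂ) :
    sys.Rr X - sys.Rr Y = sys.RrLin (X - Y) := by
  rw [Rr_eq, Rr_eq, map_sub]; abel

theorem Re_sub (X Y : Matrix (Fin M) (Fin M) ℂ) :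
    sys.Re X - sys.Re Y = sys.ReLin (X - Y) := by
  rw [Re_eq, Re_eq, map_sub]; abel

theorem RrA_sub (x y : ℝ × Matrix (Fin M) (Fin M) ℂ) :
    sys.RrA x - sys.RrA y = sys.RrALin (x - y) := by
  have h := sys.Rr_sub x.2 y.2
  simp only [RrA, RrALin, Prod.snd_sub, Prod.fst_sub, ← h, Complex.ofReal_sub]
  module

theorem ReB_sub (x y : ℝ × Matrix (Fin M) (Fin M) ℂ) :
    sys.ReB x - sys.ReB y = sys.ReBLin (x - y) := by
  have h := sys.Re_sub x.2 y.2
  simp only [ReB, ReBLin, Prod.snd_sub, Prod.fst_sub, ← h, Complex.ofReal_sub]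
  module

theorem continuous_Rr : Continuous sys.Rr :=
  (LinearMap.continuous_of_finiteDimensional sys.RrLin).add continuous_const

theorem continuous_Re : Continuous sys.Re :=
  (LinearMap.continuous_of_finiteDimensional sys.ReLin).add continuous_const

theorem continuous_RrA : Continuous sys.RrA :=
  (sys.continuous_Rr.comp continuous_snd).add (by fun_prop)

theorem continuous_ReB : Continuous sys.ReB :=
  (sys.continuous_Re.comp continuous_snd).add (by fun_prop)

theorem tagCov_posSemidef {Λ : Matrix (Fin M) (Fin M) ℂ} (hΛ : Λ.PosSemidef) :
    (sys.tagCov Λ).PosSemidef := by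
  rw [tagCov, Matrix.hadamard_one]
  exact Matrix.PosSemidef.diagonal fun i => (hΛ.conjTranspose_mul_mul_same sys.Htp).diag_nonneg

theorem A_posSemidef : sys.A.PosSemidef := by
  have h := Matrix.posSemidef_self_mul_conjTranspose (sys.Hpr * sys.Dtp)
  rwa [Matrix.conjTranspose_mul, ← Matrix.mul_assoc] at h

theorem B_posSemidef : sys.B.PosSemidef := by
  have h := Matrix.posSemidef_self_mul_conjTranspose (sys.Hpe * sys.Dtp)
  rwa [Matrix.conjTranspose_mul, ← Matrix.mul_assoc] at h

variable {sys}

theorem Rr_posDef (hα : 0 ≤ sys.α) (hβ : 0 ≤ sys.β) (hσr : 0 < sys.σr)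
    {Λ : Matrix (Fin M) (Fin M) ℂ} (hΛ : Λ.PosSemidef) : (sys.Rr Λ).PosDef := by
  have h1 := ((sys.tagCov_posSemidef hΛ).mul_mul_conjTranspose_same sys.Hpr).smul
    (Complex.zero_le_real.2 hα)
  have h2 := (hΛ.mul_mul_conjTranspose_same sys.Htr).smul (Complex.zero_le_real.2 hβ)
  have h3 : (((sys.σr ^ 2 : ℝ) : ℂ) • (1 : Matrix (Fin N) (Fin N) ℂ)).PosDef :=
    Matrix.PosDef.one.smul (Complex.zero_lt_real.2 (by positivity))
  exact h3.posSemidef_add (h1.add h2)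

theorem Re_posDef (hσe : 0 < sys.σe)
    {Λ : Matrix (Fin M) (Fin M) ℂ} (hΛ : Λ.PosSemidef) : (sys.Re Λ).PosDef := by
  have h1 := ((sys.tagCov_posSemidef hΛ).mul_mul_conjTranspose_same sys.Hpe)
  have h2 := (hΛ.mul_mul_conjTranspose_same sys.Hte)
  have h3 : (((sys.σe ^ 2 : ℝ) : ℂ) • (1 : Matrix (Fin K) (Fin K) ℂ)).PosDef :=
    Matrix.PosDef.one.smul (Complex.zero_lt_real.2 (by positivity))
  exact h3.posSemidef_add (h1.add h2)

variable (sys) in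
/-- All covariance matrices at `x` are positive definite, so that the logarithms of their
determinants are genuine values of a smooth function. -/
structure IsRegularAt (x : ℝ × Matrix (Fin M) (Fin M) ℂ) : Prop where
  rr : (sys.Rr x.2).PosDef
  re : (sys.Re x.2).PosDef
  rrA : (sys.RrA x).PosDef
  reB : (sys.ReB x).PosDef

theorem isRegularAt_of_mem (hα : 0 ≤ sys.α) (hβ : 0 ≤ sys.β) (hσr : 0 < sys.σr) (hσe : 0 < sys.σe)
    {P : ℝ} {x : ℝ × Matrix (Fin M) (Fin M) ℂ} (hx : x ∈ feasibleSet M P) : sys.IsRegularAt x where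
  rr := Rr_posDef hα hβ hσr hx.2.2
  re := Re_posDef hσe hx.2.2
  rrA := (Rr_posDef hα hβ hσr hx.2.2).add_posSemidef
    (sys.A_posSemidef.smul (Complex.zero_le_real.2 hx.2.1))
  reB := (Re_posDef hσe hx.2.2).add_posSemidef
    (sys.B_posSemidef.smul (Complex.zero_le_real.2 hx.2.1))

/-! ### The SPCA objective as a minorant, and first-order conditions -/

variable {x y z : ℝ × Matrix (Fin M) (Fin M) ℂ}

theorem spcaObjective_self (y : ℝ × Matrix (Fin M) (Fin M) ℂ) :
    sys.spcaObjective y y = sys.Cs y := by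
  simp only [spcaObjective, Matrix.logDetTangent_self, f₀, Cs]

/-- The SPCA objective minorizes `Cs`, and is equal to it only where the covariance matrices that
were linearized do not change. -/
theorem spcaObjective_le (hy : sys.IsRegularAt y) (hx : sys.IsRegularAt x) :
    sys.spcaObjective y x ≤ sys.Cs x ∧
      (sys.spcaObjective y x = sys.Cs x → sys.Rr x.2 = sys.Rr y.2 ∧ sys.ReB x = sys.ReB y) := by
  obtain ⟨h1, h2⟩ := hy.rr.logDet_le_logDetTangent hx.rr
  obtain ⟨h3, h4⟩ := hy.reB.logDet_le_logDetTangent hx.reB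
  simp only [spcaObjective, f₀, Cs]
  exact ⟨by linarith, fun h => ⟨h2 (by linarith), h4 (by linarith)⟩⟩

theorem IsRegularAt.continuousAt_Cs (hx : sys.IsRegularAt x) : ContinuousAt sys.Cs x := by
  have h1 := Matrix.PosDef.continuousAt_logDet_comp sys.continuous_RrA hx.rrA
  have h2 := Matrix.PosDef.continuousAt_logDet_comp
    (sys.continuous_Re.comp continuous_snd) hx.re
  have h3 := Matrix.PosDef.continuousAt_logDet_comp
    (sys.continuous_Rr.comp continuous_snd) hx.rr
  have h4 := Matrix.PosDef.continuousAt_logDet_comp sys.continuous_ReB hx.reB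
  exact ((h1.add h2).sub h3).sub h4

theorem IsRegularAt.tendsto_spcaObjective {ι : Type*} {l : Filter ι}
    {u v : ι → ℝ × Matrix (Fin M) (Fin M) ℂ} (hy : sys.IsRegularAt y) (hx : sys.IsRegularAt x)
    (hu : Tendsto u l (𝓝 y)) (hv : Tendsto v l (𝓝 x)) :
    Tendsto (fun i => sys.spcaObjective (u i) (v i)) l (𝓝 (sys.spcaObjective y x)) := by
  have h1 := (Matrix.PosDef.continuousAt_logDet_comp sys.continuous_RrA hx.rrA).tendsto.comp hv
  have h2 := (Matrix.PosDef.continuousAt_logDet_comp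
    (sys.continuous_Re.comp continuous_snd) hx.re).tendsto.comp hv
  have hRr : Continuous fun x : ℝ × Matrix (Fin M) (Fin M) ℂ => sys.Rr x.2 :=
    sys.continuous_Rr.comp continuous_snd
  have h3 := hy.rr.tendsto_logDetTangent ((hRr.tendsto y).comp hu) ((hRr.tendsto x).comp hv)
  have h4 := hy.reB.tendsto_logDetTangent ((sys.continuous_ReB.tendsto y).comp hu)
    ((sys.continuous_ReB.tendsto x).comp hv)
  exact ((h1.add h2).sub h3).sub h4

variable (sys) in
/-- The derivative of `Cs` at `z` in the direction `v`. -/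
def CsDeriv (z v : ℝ × Matrix (Fin M) (Fin M) ℂ) : ℝ :=
  ((sys.RrA z)⁻¹ * sys.RrALin v).trace.re + ((sys.Re z.2)⁻¹ * sys.ReLin v.2).trace.re
    - ((sys.Rr z.2)⁻¹ * sys.RrLin v.2).trace.re - ((sys.ReB z)⁻¹ * sys.ReBLin v).trace.re

theorem IsRegularAt.hasDerivAt_f₀ (hz : sys.IsRegularAt z)
    (v : ℝ × Matrix (Fin M) (Fin M) ℂ) :
    HasDerivAt (fun t : ℝ => sys.f₀ (z + t • v))
      (((sys.RrA z)⁻¹ * sys.RrALin v).trace.re + ((sys.Re z.2)⁻¹ * sys.ReLin v.2).trace.re) 0 := by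
  simp only [f₀, Prod.snd_add, Prod.smul_snd, RrA_line, Re_line]
  exact (hz.rrA.hasDerivAt_logDet _).add (hz.re.hasDerivAt_logDet _)

theorem IsRegularAt.hasDerivAt_Cs (hz : sys.IsRegularAt z)
    (v : ℝ × Matrix (Fin M) (Fin M) ℂ) :
    HasDerivAt (fun t : ℝ => sys.Cs (z + t • v)) (sys.CsDeriv z v) 0 := by
  have h1 := hz.hasDerivAt_f₀ v
  have h2 := hz.rr.hasDerivAt_logDet (sys.RrLin v.2)
  have h3 := hz.reB.hasDerivAt_logDet (sys.ReBLin v)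
  simp only [← Rr_line, ← ReB_line] at h2 h3
  exact (h1.sub h2).sub h3

/-- At the point of linearization the SPCA objective has the same derivatives as `Cs`. -/
theorem IsRegularAt.hasDerivAt_spcaObjective (hz : sys.IsRegularAt z)
    (v : ℝ × Matrix (Fin M) (Fin M) ℂ) :
    HasDerivAt (fun t : ℝ => sys.spcaObjective z (z + t • v)) (sys.CsDeriv z v) 0 := by
  have key : ∀ {n : ℕ} (X V : Matrix (Fin n) (Fin n) ℂ),
      HasDerivAt (fun t : ℝ => logDetTangent X (X + (t : ℂ) • V)) (X⁻¹ * V).trace.re 0 := by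
    intro n X V
    have h : (fun t : ℝ => logDetTangent X (X + (t : ℂ) • V)) =
        fun t => logDet X + t * (X⁻¹ * V).trace.re := by
      funext t
      simp [logDetTangent]
    rw [h]
    simpa using ((hasDerivAt_id (0 : ℝ)).mul_const (X⁻¹ * V).trace.re).const_add (logDet X)
  have h2 := key (sys.Rr z.2) (sys.RrLin v.2)
  have h3 := key (sys.ReB z) (sys.ReBLin v)
  simp only [← Rr_line, ← ReB_line] at h2 h3
  exact ((hz.hasDerivAt_f₀ v).sub h2).sub h3

/-- The derivative of `Cs` is given on the matrix component by a complex linear functional. -/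
theorem exists_CsDeriv_eq (z : ℝ × Matrix (Fin M) (Fin M) ℂ) :
    ∃ (g : ℝ) (ψ : Matrix (Fin M) (Fin M) ℂ →ₗ[ℂ] ℂ), ∀ v,
      sys.CsDeriv z v = g * v.1 + (ψ v.2).re := by
  refine ⟨((sys.RrA z)⁻¹ * sys.A).trace.re - ((sys.ReB z)⁻¹ * sys.B).trace.re,
    Matrix.traceLinearMap _ ℂ ℂ ∘ₗ (LinearMap.mulLeft ℂ (sys.RrA z)⁻¹ ∘ₗ sys.RrLin)
    + Matrix.traceLinearMap _ ℂ ℂ ∘ₗ (LinearMap.mulLeft ℂ (sys.Re z.2)⁻¹ ∘ₗ sys.ReLin)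
    - Matrix.traceLinearMap _ ℂ ℂ ∘ₗ (LinearMap.mulLeft ℂ (sys.Rr z.2)⁻¹ ∘ₗ sys.RrLin)
    - Matrix.traceLinearMap _ ℂ ℂ ∘ₗ (LinearMap.mulLeft ℂ (sys.ReB z)⁻¹ ∘ₗ sys.ReLin),
    fun v => ?_⟩
  simp [CsDeriv, RrALin, ReBLin, mul_add]
  ring

/-- A feasible point that maximizes its own SPCA problem is a KKT point. -/
theorem isKKT_of_isMaxOn {P : ℝ} (hreg : sys.IsRegularAt z) (hz : z ∈ feasibleSet M P)
    (hmax : IsMaxOn (sys.spcaObjective z) (feasibleSet M P) z) : sys.IsKKT P z := by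
  obtain ⟨g, ψ, hgψ⟩ := exists_CsDeriv_eq (sys := sys) z
  obtain ⟨l, m, Z, hl, hm, hZ, c1, c2, c3, hstat⟩ :=
    exists_multipliers_of_forall_le hz g ψ (by
      intro y hy
      have h1 := (hreg.hasDerivAt_spcaObjective (y - z)).hasDerivWithinAt (s := Set.Ioi 0)
      rw [hasDerivWithinAt_iff_tendsto_slope' (by simp), hgψ] at h1
      refine le_of_tendsto h1 ?_
      filter_upwards [Ioo_mem_nhdsGT (zero_lt_one' ℝ)] with t ht
      have h2 : z + t • (y - z) ∈ feasibleSet M P :=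
        (convex_feasibleSet M P).add_smul_sub_mem hz hy ⟨ht.1.le, ht.2.le⟩
      have h3 : sys.spcaObjective z (z + t • (y - z)) ≤ sys.spcaObjective z z := hmax h2
      rw [slope_def_field, zero_smul, add_zero]
      exact div_nonpos_of_nonpos_of_nonneg (by linarith) (by linarith [ht.1]))
  refine ⟨hz, l, m, Z, hl, hm, hZ, c1, c2, c3, fun v hv => ?_⟩
  have hlin : HasDerivAt (fun t : ℝ => l * (P - (z + t • v).1 - (z + t • v).2.trace.re)
      + m * (z + t • v).1 + (Z * (z + t • v).2).trace.re)
      (l * (-v.1 - v.2.trace.re) + m * v.1 + (Z * v.2).trace.re) 0 := by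
    have : (fun t : ℝ => l * (P - (z + t • v).1 - (z + t • v).2.trace.re)
        + m * (z + t • v).1 + (Z * (z + t • v).2).trace.re) = fun t =>
        (l * (P - z.1 - z.2.trace.re) + m * z.1 + (Z * z.2).trace.re) +
          t * (l * (-v.1 - v.2.trace.re) + m * v.1 + (Z * v.2).trace.re) := by
      funext t
      simp [mul_add]
      ring
    rw [this]
    simpa using ((hasDerivAt_id (0 : ℝ)).mul_const
      (l * (-v.1 - v.2.trace.re) + m * v.1 + (Z * v.2).trace.re)).const_add
      (l * (P - z.1 - z.2.trace.re) + m * z.1 + (Z * z.2).trace.re)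
  have h := (hreg.hasDerivAt_Cs v).add hlin
  rw [hgψ, show g * v.1 + (ψ v.2).re + (l * (-v.1 - v.2.trace.re) + m * v.1 + (Z * v.2).trace.re)
    = 0 by linarith [hstat v hv]] at h
  unfold HasLineDerivAt lagrangian
  convert h using 1
  funext t
  simp only [Pi.add_apply]
  ring

end BackscatterSystem

/-! ### Alternating optimization as an instance of SPCA -/

namespace Matrix

theorem PosDef.elogDet_eq {n : ℕ} {S : Matrix (Fin n) (Fin n) ℂ} (hS : S.PosDef) :
    elogDet S = (logDet S : EReal) :=
  ENNReal.log_ofReal_of_pos hS.det_re_pos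

theorem PosSemidef.elogDet_eq_bot {n : ℕ} {S : Matrix (Fin n) (Fin n) ℂ} (hS : S.PosSemidef)
    (h : ¬ S.PosDef) : elogDet S = ⊥ := by
  have h0 : S.det.re = 0 := by
    by_contra h0
    exact h (hS.posDef_of_det_re_ne_zero h0)
  rw [elogDet, h0, ENNReal.ofReal_zero, ENNReal.log_zero]

end Matrix

namespace BackscatterSystem

variable {M N L K : ℕ} {sys : BackscatterSystem M N L K}
  {x y z w : ℝ × Matrix (Fin M) (Fin M) ℂ} {P : ℝ}

/-- The first half-step of alternating optimization has a unique solution. -/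
theorem IsRegularAt.eq_inv_of_isMaxOn_aoAuxObjective (hy : sys.IsRegularAt y)
    {S : Matrix (Fin N) (Fin N) ℂ × Matrix (Fin K) (Fin K) ℂ}
    (h1 : S.1.PosSemidef) (h2 : S.2.PosSemidef)
    (hmax : IsMaxOn (sys.aoAuxObjective y) {T | T.1.PosSemidef ∧ T.2.PosSemidef} S) :
    S.1 = (sys.Rr y.2)⁻¹ ∧ S.2 = (sys.ReB y)⁻¹ := by
  have key : sys.aoAuxObjective y ((sys.Rr y.2)⁻¹, (sys.ReB y)⁻¹) ≤ sys.aoAuxObjective y S :=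
    hmax (a := ((sys.Rr y.2)⁻¹, (sys.ReB y)⁻¹)) ⟨hy.rr.inv.posSemidef, hy.reB.inv.posSemidef⟩
  simp only [aoAuxObjective, hy.rr.inv.elogDet_eq, hy.reB.inv.elogDet_eq] at key
  rw [← EReal.coe_add, ← EReal.coe_add] at key
  by_cases p1 : S.1.PosDef
  · by_cases p2 : S.2.PosDef
    · rw [p1.elogDet_eq, p2.elogDet_eq, ← EReal.coe_add, ← EReal.coe_add,
        EReal.coe_le_coe_iff] at key
      obtain ⟨a1, a2⟩ := p1.logDet_sub_trace_le hy.rr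
      obtain ⟨b1, b2⟩ := p2.logDet_sub_trace_le hy.reB
      rw [hy.rr.logDet_inv, hy.reB.logDet_inv,
        Matrix.nonsing_inv_mul _ ((Matrix.isUnit_iff_isUnit_det _).1 hy.rr.isUnit),
        Matrix.nonsing_inv_mul _ ((Matrix.isUnit_iff_isUnit_det _).1 hy.reB.isUnit)] at key
      simp only [Matrix.trace_one, Fintype.card_fin, Complex.natCast_re] at key
      exact ⟨a2 (by linarith), b2 (by linarith)⟩
    · rw [h2.elogDet_eq_bot p2, EReal.add_bot, EReal.bot_add] at key
      exact absurd (le_bot_iff.1 key) (EReal.coe_ne_bot _)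
  · rw [h1.elogDet_eq_bot p1, EReal.bot_add, EReal.bot_add] at key
    exact absurd (le_bot_iff.1 key) (EReal.coe_ne_bot _)

/-- For the optimal auxiliary variables the second half-step of alternating optimization has the
objective of the SPCA problem, up to a constant. -/
theorem aoObjective_inv (x y : ℝ × Matrix (Fin M) (Fin M) ℂ) :
    sys.aoObjective ((sys.Rr y.2)⁻¹, (sys.ReB y)⁻¹) x = sys.spcaObjective y x
      + (logDet (sys.Rr y.2) - ((sys.Rr y.2)⁻¹ * sys.Rr y.2).trace.re
        + logDet (sys.ReB y) - ((sys.ReB y)⁻¹ * sys.ReB y).trace.re) := by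
  simp only [aoObjective, spcaObjective, f₀, logDetTangent, mul_sub, Matrix.trace_sub,
    Complex.sub_re]
  ring

theorem IsAOSequence.isSPCASequence (hreg : ∀ y ∈ feasibleSet M P, sys.IsRegularAt y)
    {x : ℕ → ℝ × Matrix (Fin M) (Fin M) ℂ} (hx : sys.IsAOSequence P x) :
    sys.IsSPCASequence P x := by
  obtain ⟨h0, S, hS⟩ := hx
  have hmem : ∀ n, x n ∈ feasibleSet M P := by
    intro n
    cases n with
    | zero => exact h0
    | succ n => exact (hS n).2.1
  refine ⟨h0, fun n => ⟨hmem (n + 1), fun y hy => ?_⟩⟩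
  obtain ⟨⟨p1, p2, hmax⟩, -, hmax'⟩ := hS n
  have hSn := (hreg _ (hmem n)).eq_inv_of_isMaxOn_aoAuxObjective p1 p2 hmax
  have h := hmax' hy
  rw [Set.mem_ofPred_eq, show S (n + 1) = ((sys.Rr (x n).2)⁻¹, (sys.ReB (x n))⁻¹) from
    Prod.ext hSn.1 hSn.2, aoObjective_inv, aoObjective_inv] at h
  exact le_of_add_le_add_right h

/-! ### Secrecy rate in bits -/

theorem IsRegularAt.logb_det_eq (hx : sys.IsRegularAt x) :
    Real.logb 2 (1 + (x.1 : ℂ) • (sys.A * (sys.Rr x.2)⁻¹)).det.re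
      - Real.logb 2 (1 + (x.1 : ℂ) • (sys.B * (sys.Re x.2)⁻¹)).det.re
      = sys.Cs x / Real.log 2 := by
  have key : ∀ {n : ℕ} {X A : Matrix (Fin n) (Fin n) ℂ}, X.PosDef → (X + (x.1 : ℂ) • A).PosDef →
      Real.log (1 + (x.1 : ℂ) • (A * X⁻¹)).det.re = logDet (X + (x.1 : ℂ) • A) - logDet X := by
    intro n X A hX hXA
    have h1 : (1 + (x.1 : ℂ) • (A * X⁻¹)).det * X.det = (X + (x.1 : ℂ) • A).det := by
      rw [← Matrix.det_mul, add_mul, one_mul, smul_mul_assoc, mul_assoc,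
        Matrix.nonsing_inv_mul _ ((Matrix.isUnit_iff_isUnit_det _).1 hX.isUnit), mul_one]
    have h2 : (1 + (x.1 : ℂ) • (A * X⁻¹)).det.re = (X + (x.1 : ℂ) • A).det.re / X.det.re := by
      rw [← h1, Complex.mul_re, hX.det_im_eq_zero, mul_zero, sub_zero,
        mul_div_cancel_right₀ _ hX.det_re_pos.ne']
    rw [h2, Real.log_div hXA.det_re_pos.ne' hX.det_re_pos.ne', logDet, logDet]
  have h1 := key hx.rr hx.rrA
  have h2 := key hx.re hx.reB
  rw [Real.logb, Real.logb, h1, h2, ← sub_div]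
  congr 1
  simp only [Cs, RrA, ReB]
  ring

/-! ### Convergence of the iterates -/

theorem IsSPCASequence.mem {x : ℕ → ℝ × Matrix (Fin M) (Fin M) ℂ} (hx : sys.IsSPCASequence P x)
    (n : ℕ) : x n ∈ feasibleSet M P := by
  cases n with
  | zero => exact hx.1
  | succ n => exact (hx.2 n).1

theorem IsSPCASequence.Cs_le {x : ℕ → ℝ × Matrix (Fin M) (Fin M) ℂ} (hx : sys.IsSPCASequence P x) (n : ℕ) :
    sys.Cs (x n) ≤ sys.spcaObjective (x n) (x (n + 1)) := by
  rw [← spcaObjective_self]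
  exact (hx.2 n).2 (hx.mem n)

theorem IsSPCASequence.monotone_Cs (hreg : ∀ y ∈ feasibleSet M P, sys.IsRegularAt y)
    {x : ℕ → ℝ × Matrix (Fin M) (Fin M) ℂ} (hx : sys.IsSPCASequence P x) :
    Monotone fun n => sys.Cs (x n) :=
  monotone_nat_of_le_succ fun n => (hx.Cs_le n).trans
    (spcaObjective_le (hreg _ (hx.mem n)) (hreg _ (hx.mem (n + 1)))).1

/-- Limits along any reindexing are feasible; the shift by one is the case of the successors. -/
theorem IsSPCASequence.mem_of_tendsto {x : ℕ → ℝ × Matrix (Fin M) (Fin M) ℂ}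
    (hx : sys.IsSPCASequence P x) {F : Ultrafilter ℕ} {φ : ℕ → ℕ}
    (hz : Tendsto (fun n => x (φ n)) F (𝓝 z)) : z ∈ feasibleSet M P :=
  (isCompact_feasibleSet M P).isClosed.mem_of_tendsto hz (Eventually.of_forall fun _ => hx.mem _)

theorem IsSPCASequence.tendsto_Cs (hreg : ∀ y ∈ feasibleSet M P, sys.IsRegularAt y)
    {x : ℕ → ℝ × Matrix (Fin M) (Fin M) ℂ} (hx : sys.IsSPCASequence P x)
    {F : Ultrafilter ℕ} (hF : (F : Filter ℕ) ≤ atTop) (hz : Tendsto x F (𝓝 z)) :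
    Tendsto (fun n => sys.Cs (x n)) atTop (𝓝 (sys.Cs z)) := by
  have h1 : Tendsto (fun n => sys.Cs (x n)) F (𝓝 (sys.Cs z)) :=
    (hreg z (hx.mem_of_tendsto (φ := id) hz)).continuousAt_Cs.tendsto.comp hz
  rcases tendsto_atTop_of_monotone (hx.monotone_Cs hreg) with h | ⟨l, h⟩
  · exact absurd h1 (not_tendsto_nhds_of_tendsto_atTop (h.mono_left hF) _)
  · rwa [tendsto_nhds_unique h1 (h.mono_left hF)]

/-- A limit point of the iterates maximizes its own SPCA problem: the inequality
`spca (x n) y ≤ spca (x n) (x (n + 1)) ≤ Cs (x (n + 1))` passes to the limit. -/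
theorem IsSPCASequence.isMaxOn_of_tendsto (hreg : ∀ y ∈ feasibleSet M P, sys.IsRegularAt y)
    {x : ℕ → ℝ × Matrix (Fin M) (Fin M) ℂ} (hx : sys.IsSPCASequence P x)
    {F : Ultrafilter ℕ} (hF : (F : Filter ℕ) ≤ atTop) (hz : Tendsto x F (𝓝 z)) :
    IsMaxOn (sys.spcaObjective z) (feasibleSet M P) z := by
  intro y hy
  have hzm := hx.mem_of_tendsto (φ := id) hz
  have h1 : Tendsto (fun n => sys.spcaObjective (x n) y) F (𝓝 (sys.spcaObjective z y)) :=
    (hreg z hzm).tendsto_spcaObjective (hreg y hy) hz tendsto_const_nhds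
  have h2 := ((hx.tendsto_Cs hreg hF hz).comp (tendsto_add_atTop_nat 1)).mono_left hF
  change sys.spcaObjective z y ≤ sys.spcaObjective z z
  rw [spcaObjective_self]
  exact le_of_tendsto_of_tendsto' h1 h2 fun n => ((hx.2 n).2 hy).trans
    (spcaObjective_le (hreg _ (hx.mem n)) (hreg _ (hx.mem (n + 1)))).1

/-- The SPCA objective depends on the point of linearization only through `Rr` and `ReB`. -/
theorem spcaObjective_congr (h1 : sys.Rr y.2 = sys.Rr z.2) (h2 : sys.ReB y = sys.ReB z) :
    sys.spcaObjective y = sys.spcaObjective z := by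
  funext x
  simp only [spcaObjective, h1, h2]

/-- If `w` has the same objective value as `z` and the tangents at `z` are exact at `w`, then
the whole segment from `z` to `w` solves its own SPCA problems. -/
theorem isMaxOn_segment (hreg : ∀ y ∈ feasibleSet M P, sys.IsRegularAt y)
    (hz : z ∈ feasibleSet M P) (hw : w ∈ feasibleSet M P)
    (hmax : IsMaxOn (sys.spcaObjective z) (feasibleSet M P) z)
    (hCs : sys.Cs w = sys.Cs z) (hRr : sys.Rr w.2 = sys.Rr z.2) (hReB : sys.ReB w = sys.ReB z)
    {t : ℝ} (ht : t ∈ Set.Icc (0 : ℝ) 1) :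
    IsMaxOn (sys.spcaObjective (z + t • (w - z))) (feasibleSet M P) (z + t • (w - z)) := by
  set u := z + t • (w - z) with hu
  have hum : u ∈ feasibleSet M P := (convex_feasibleSet M P).add_smul_sub_mem hz hw ht
  have hRru : sys.Rr u.2 = sys.Rr z.2 := by
    have h := sys.Rr_line z.2 (w.2 - z.2) t
    rw [← Rr_sub, hRr, sub_self, smul_zero, add_zero] at h
    exact h
  have hReBu : sys.ReB u = sys.ReB z := by
    rw [hu, ReB_line, ← ReB_sub, hReB, sub_self, smul_zero, add_zero]
  have hRrAu : sys.RrA u = ((1 - t : ℝ) : ℂ) • sys.RrA z + (t : ℂ) • sys.RrA w := by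
    rw [hu, RrA_line, ← RrA_sub, Complex.ofReal_sub, Complex.ofReal_one]
    module
  have hReu : sys.Re u.2 = ((1 - t : ℝ) : ℂ) • sys.Re z.2 + (t : ℂ) • sys.Re w.2 := by
    have h := sys.Re_line z.2 (w.2 - z.2) t
    rw [← Re_sub] at h
    rw [Complex.ofReal_sub, Complex.ofReal_one]
    refine Eq.trans h ?_
    module
  have hconc : sys.Cs z ≤ sys.Cs u := by
    have hru := hreg u hum
    have h1 := (hreg z hz).rrA.le_logDet_convexCombo (hreg w hw).rrA (a := 1 - t) (b := t)
      (by linarith [ht.2]) ht.1 (by ring) (by rw [← hRrAu]; exact hru.rrA)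
    have h2 := (hreg z hz).re.le_logDet_convexCombo (hreg w hw).re (a := 1 - t) (b := t)
      (by linarith [ht.2]) ht.1 (by ring) (by rw [← hReu]; exact hru.re)
    rw [← hRrAu] at h1
    rw [← hReu] at h2
    simp only [Cs, hRru, hReBu, hRr, hReB] at hCs ⊢
    have h3 : logDet (sys.RrA w) + logDet (sys.Re w.2) =
      logDet (sys.RrA z) + logDet (sys.Re z.2) := by linarith
    have h4 := congrArg (t * ·) h3
    simp only [mul_add] at h4
    linarith
  rw [spcaObjective_congr hRru hReBu]
  intro y hy
  have hyz : sys.spcaObjective z y ≤ sys.spcaObjective z z := hmax hy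
  refine hyz.trans ?_
  rw [← spcaObjective_congr hRru hReBu, spcaObjective_self,
    spcaObjective_congr hRru hReBu, spcaObjective_self]
  exact hconc

/-- If the iterates tend to an isolated KKT point along an ultrafilter, then so do their
successors. Otherwise the limit of the successors would be another maximizer of the SPCA problem
at `z`, at which the tangents are exact, and the segment between the two limits would consist of
KKT points. -/
theorem IsSPCASequence.eq_of_tendsto_succ (hreg : ∀ y ∈ feasibleSet M P, sys.IsRegularAt y)
    {x : ℕ → ℝ × Matrix (Fin M) (Fin M) ℂ} (hx : sys.IsSPCASequence P x)
    {F : Ultrafilter ℕ} (hF : (F : Filter ℕ) ≤ atTop) (hz : Tendsto x F (𝓝 z))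
    (hw : Tendsto (fun n => x (n + 1)) F (𝓝 w)) (hiso : ¬ AccPt z (𝓟 {y | sys.IsKKT P y})) :
    w = z := by
  have hzm := hx.mem_of_tendsto (φ := id) hz
  have hwm := hx.mem_of_tendsto (φ := fun n => n + 1) hw
  have hmax := hx.isMaxOn_of_tendsto hreg hF hz
  have hlim := hx.tendsto_Cs hreg hF hz
  have hCs : sys.Cs w = sys.Cs z :=
    tendsto_nhds_unique ((hreg w hwm).continuousAt_Cs.tendsto.comp hw)
      ((hlim.comp (tendsto_add_atTop_nat 1)).mono_left hF)
  -- `Cs (x n) ≤ spca (x n) (x (n + 1)) ≤ Cs (x (n + 1))` and both bounds tend to `Cs z`.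
  have hzw : sys.spcaObjective z w = sys.Cs w := by
    refine le_antisymm (spcaObjective_le (hreg z hzm) (hreg w hwm)).1 ?_
    rw [hCs]
    exact le_of_tendsto_of_tendsto' (hlim.mono_left hF)
      ((hreg z hzm).tendsto_spcaObjective (hreg w hwm) hz hw) hx.Cs_le
  obtain ⟨hRr, hReB⟩ := (spcaObjective_le (hreg z hzm) (hreg w hwm)).2 hzw
  by_contra hne
  refine hiso (accPt_iff_frequently.2 ?_)
  have hseg : Tendsto (fun t : ℝ => z + t • (w - z)) (𝓝[>] 0) (𝓝 z) := by
    have h : Continuous fun t : ℝ => z + t • (w - z) := by fun_prop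
    have := h.tendsto 0
    rw [zero_smul, add_zero] at this
    exact this.mono_left nhdsWithin_le_nhds
  refine hseg.frequently (Eventually.frequently ?_)
  filter_upwards [Ioc_mem_nhdsGT (zero_lt_one' ℝ)] with t ht
  refine ⟨fun h => ?_, ?_⟩
  · rw [add_eq_left, smul_eq_zero, sub_eq_zero] at h
    exact h.elim ht.1.ne' hne
  · have hum := (convex_feasibleSet M P).add_smul_sub_mem hzm hwm (Set.Ioc_subset_Icc_self ht)
    exact isKKT_of_isMaxOn (hreg _ hum) hum
      (isMaxOn_segment hreg hzm hwm hmax hCs hRr hReB (Set.Ioc_subset_Icc_self ht))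

theorem IsSPCASequence.isKKT_of_mapClusterPt (hreg : ∀ y ∈ feasibleSet M P, sys.IsRegularAt y)
    {x : ℕ → ℝ × Matrix (Fin M) (Fin M) ℂ} (hx : sys.IsSPCASequence P x)
    (hz : MapClusterPt z atTop x) : sys.IsKKT P z := by
  obtain ⟨F, hF, hFz⟩ := mapClusterPt_iff_ultrafilter.1 hz
  have hzm := hx.mem_of_tendsto (φ := id) hFz
  exact isKKT_of_isMaxOn (hreg z hzm) hzm (hx.isMaxOn_of_tendsto hreg hF hFz)

/-- The iterates visit every closed neighbourhood `W` of `z` infinitely often. If `z` is the only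
KKT point in `W`, then they leave `W` only finitely often: an ultrafilter on the exit times would
give limits `z` of `x n` and `w ≠ z` of `x (n + 1)`. -/
theorem IsSPCASequence.tendsto_of_not_accPt (hreg : ∀ y ∈ feasibleSet M P, sys.IsRegularAt y)
    {x : ℕ → ℝ × Matrix (Fin M) (Fin M) ℂ} (hx : sys.IsSPCASequence P x)
    (hz : MapClusterPt z atTop x) (hiso : ¬ AccPt z (𝓟 {y | sys.IsKKT P y})) :
    Tendsto x atTop (𝓝 z) := by
  have hcomp : ∀ (F : Ultrafilter ℕ) (φ : ℕ → ℕ), ∃ w, Tendsto (fun n => x (φ n)) F (𝓝 w) := by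
    intro F φ
    obtain ⟨w, -, hw⟩ := (isCompact_feasibleSet M P).ultrafilter_le_nhds'
      (F.map fun n => x (φ n)) (Ultrafilter.mem_map.2 (univ_mem' fun n => hx.mem (φ n)))
    exact ⟨w, hw⟩
  have hiso' : ∀ᶠ y in 𝓝 z, sys.IsKKT P y → y = z := by
    rw [accPt_iff_frequently, not_frequently] at hiso
    filter_upwards [hiso] with y hy hK
    by_contra hne
    exact hy ⟨hne, hK⟩
  refine (closed_nhds_basis z).tendsto_right_iff.2 fun V ⟨hV, hVc⟩ => ?_
  obtain ⟨W', ⟨hW', hWc'⟩, hWsub⟩ := (closed_nhds_basis z).mem_iff.1 hiso'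
  set W := V ∩ W' with hWdef
  have hW : W ∈ 𝓝 z := inter_mem hV hW'
  have hWc : IsClosed W := hVc.inter hWc'
  have hstay : ∀ᶠ n in atTop, x n ∈ W → x (n + 1) ∈ W := by
    by_contra hcon
    rw [not_eventually, frequently_iff_neBot] at hcon
    set F := @Ultrafilter.of _ _ hcon with hFdef
    have hF := @Ultrafilter.of_le _ _ hcon
    have hFtop : (F : Filter ℕ) ≤ atTop := hF.trans inf_le_left
    have hFex : ∀ᶠ n in (F : Filter ℕ), ¬ (x n ∈ W → x (n + 1) ∈ W) :=
      le_principal_iff.1 (hF.trans inf_le_right)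
    obtain ⟨z', hz'⟩ := hcomp F id
    obtain ⟨w, hw⟩ := hcomp F (· + 1)
    have hz'W : z' ∈ W := hWc.mem_of_tendsto hz' (hFex.mono fun n hn => by
      by_contra h
      exact hn fun h' => absurd h' h)
    have hz'z : z' = z := hWsub hz'W.2
      (hx.isKKT_of_mapClusterPt hreg (mapClusterPt_iff_ultrafilter.2 ⟨F, hFtop, hz'⟩))
    rw [hz'z] at hz'
    rw [hx.eq_of_tendsto_succ hreg hFtop hz' hw hiso] at hw
    obtain ⟨n, hn1, hn2⟩ := ((hw.eventually hW).and hFex).exists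
    exact hn2 fun _ => hn1
  obtain ⟨n₀, hn₀⟩ := eventually_atTop.1 hstay
  obtain ⟨n₁, hn₁, hxn₁⟩ := frequently_atTop.1 (hz.frequently hW) n₀
  filter_upwards [eventually_ge_atTop n₁] with n hn
  have : x n ∈ W := by
    induction n, hn using Nat.le_induction with
    | base => exact hxn₁
    | succ n hn ih => exact hn₀ n (hn₁.trans hn) ih
  exact this.1

end BackscatterSystem
end

theorem theorem1 {M N L K : ℕ} (sys : BackscatterSystem M N L K)
    (hα : sys.α ∈ Set.Icc (0 : ℝ) 1) (hβ : sys.β ∈ Set.Icc (0 : ℝ) 1)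
    (hσr : 0 < sys.σr) (hσe : 0 < sys.σe) (P : ℝ)
    (x : ℕ → ℝ × Matrix (Fin M) (Fin M) ℂ)
    (hx : sys.IsAOSequence P x ∨ sys.IsSPCASequence P x) :
    -- the secrecy rates are non-decreasing
    Monotone (fun n => sys.Cs (x n)) ∧
    Monotone (fun n => sys.achievableSecrecyRate (x n)) ∧
    -- the iterates have a limit point; each limit point is a KKT point, at which
    -- the limit of the secrecy rates is attained
    (∃ z, MapClusterPt z atTop x) ∧
    (∀ z, MapClusterPt z atTop x →
      sys.IsKKT P z ∧ Tendsto (fun n => sys.Cs (x n)) atTop (𝓝 (sys.Cs z))) ∧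
    -- the iterates converge to the set of KKT points
    Tendsto x atTop (𝓝ˢ {z | sys.IsKKT P z}) ∧
    -- they converge to a single KKT point as soon as one limit point is an isolated KKT point
    (∀ z, MapClusterPt z atTop x → ¬ AccPt z (𝓟 {w | sys.IsKKT P w}) →
      Tendsto x atTop (𝓝 z)) := by
  have hreg : ∀ y ∈ feasibleSet M P, sys.IsRegularAt y := fun y hy =>
    BackscatterSystem.isRegularAt_of_mem hα.1 hβ.1 hσr hσe hy
  replace hx : sys.IsSPCASequence P x := hx.elim (fun h => h.isSPCASequence hreg) id
  have hmono := hx.monotone_Cs hreg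
  have hK := isCompact_feasibleSet M P
  refine ⟨hmono, fun m n hmn => ?_, ?_, fun z hz => ⟨hx.isKKT_of_mapClusterPt hreg hz, ?_⟩, ?_,
    fun z hz hiso => hx.tendsto_of_not_accPt hreg hz hiso⟩
  · simp only [BackscatterSystem.achievableSecrecyRate, (hreg _ (hx.mem _)).logb_det_eq]
    exact max_le_max le_rfl
      (div_le_div_of_nonneg_right (hmono hmn) (Real.log_pos one_lt_two).le)
  · obtain ⟨z, -, hz⟩ := hK.exists_mapClusterPt (f := atTop) (u := x)
      (tendsto_principal.2 (Eventually.of_forall hx.mem))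
    exact ⟨z, hz⟩
  · obtain ⟨F, hF, hFz⟩ := mapClusterPt_iff_ultrafilter.1 hz
    exact hx.tendsto_Cs hreg hF hFz
  · exact hK.tendsto_nhdsSet_of_mapClusterPt (Eventually.of_forall hx.mem)
      fun z _ hz => hx.isKKT_of_mapClusterPt hreg hz
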